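/- Let $\mu$ be a finite positive Borel measure on $\mathbb{R}$ with compact support, and let $E=\sigma_{\mathrm{ess}}(\mu)$ be the set of nonisolated points of $\operatorname{supp}\mu$. For a probability measure $\nu$ with compact support let $\mathcal{E}(\nu)=\iint \log|x-y|^{-1}\,d\nu(x)\,d\nu(y)\in(-\infty,+\infty]$, and for a compact set $K$ let the capacity be $C(K)=\exp\bigl(-\inf\{\mathcal{E}(\nu) : \nu \text{ a probability measure on } K\}\bigr)$, with $\inf\emptyset=+\infty$ and $\exp(-\infty)=0$. Suppose that $C(E)>0$, let $\rho_E$ be the equilibrium measure of $E$ (the probability measure on $E$ that minimizes $\mathcal{E}$), and suppose that $\rho_E$ is absolutely continuous with respect to $\mu$; equivalently, $d\mu=w\,d\rho_E+d\mu_s$ with $\mu_s$ singular with respect to $\rho_E$ and $w>0$ $\rho_E$-almost everywhere. Then $\mu$ is regular, that is, its monic orthogonal polynomials $P_n$ (of degree $n$) satisfy $$\lim_{n\to\infty}\|P_n\|_{L^2(\mu)}^{1/n}=C(\operatorname{supp}\mu).$$ -/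

import Mathlib

open MeasureTheory Filter Topology Polynomial
open scoped ENNReal

/-- The logarithmic kernel `log |x - y|⁻¹`, with the value `+∞` on the diagonal. It is used for
`X = ℝ`; for `X = ℂ` the definitions below are those of planar potential theory, and for a compact
`E ⊆ ℝ` the measures on `E` are the same in `ℝ` and in `ℂ`. -/
noncomputable def logKernel {X : Type*} [MetricSpace X] (x y : X) : EReal :=
  -ENNReal.log (edist x y)

/-- The Coulomb energy `∬ log |x - y|⁻¹ dν(x) dν(y)`, as the integral of the positive part of the
kernel minus the integral of its negative part. If `ν` is finite with compact support, then the
latter is finite and the energy lies in `(-∞, +∞]`. -/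
noncomputable def logEnergy {X : Type*} [MetricSpace X] [MeasurableSpace X]
    (ν : Measure X) : EReal :=
  ((∫⁻ x, ∫⁻ y, (logKernel x y).toENNReal ∂ν ∂ν : ℝ≥0∞) : EReal) -
    ((∫⁻ x, ∫⁻ y, (-logKernel x y).toENNReal ∂ν ∂ν : ℝ≥0∞) : EReal)

/-- The Borel probability measures on (that is, carried by) the set `E`. -/
def probOn {X : Type*} [MeasurableSpace X] (E : Set X) : Set (Measure X) :=
  {ν | IsProbabilityMeasure ν ∧ ν Eᶜ = 0}

/-- The logarithmic capacity `exp (- inf {energy of ν | ν a probability measure on E})` of a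
compact set `E`, with `exp (-∞) = 0`: it is zero exactly when every probability measure on `E` has
infinite energy. -/
noncomputable def logCapacity {X : Type*} [MetricSpace X] [MeasurableSpace X]
    (E : Set X) : ℝ≥0∞ :=
  EReal.exp (-⨅ ν ∈ probOn E, logEnergy ν)

/-- `ρ` is the equilibrium measure of the compact set `E`: the minimizer of the energy among the
probability measures on `E` (unique if `E` has positive capacity). -/
def IsEquilibriumMeasure {X : Type*} [MetricSpace X] [MeasurableSpace X]
    (E : Set X) (ρ : Measure X) : Prop :=
  ρ ∈ probOn E ∧ ∀ ν ∈ probOn E, logEnergy ρ ≤ logEnergy ν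

/-- The essential spectrum of a measure: the nonisolated points of its support. -/
def sigmaEss (μ : Measure ℝ) : Set ℝ :=
  {x | x ∈ μ.support ∧ AccPt x (𝓟 μ.support)}

/-- `P 0, P 1, …` are monic orthogonal polynomials of the measure `μ`. -/
def IsMonicOrthogonal (μ : Measure ℝ) (P : ℕ → ℝ[X]) : Prop :=
  (∀ n, (P n).Monic ∧ (P n).natDegree = n) ∧
    ∀ m n, m ≠ n → ∫ x, (P m).eval x * (P n).eval x ∂μ = 0

/-- A finite measure `μ` of compact support is regular: its monic orthogonal polynomials satisfy
`‖P n‖ ^ (1 / n) → C(supp μ)` in the norm of `L²(μ)`. (Such `P n` exist, and their norms are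
determined by `μ`, as `P n` minimizes the norm among the monic polynomials of degree `n`.) -/
def IsRegularMeasure (μ : Measure ℝ) : Prop :=
  ∃ P : ℕ → ℝ[X], IsMonicOrthogonal μ P ∧
    Tendsto (fun n : ℕ => eLpNorm (fun x => (P n).eval x) 2 μ ^ (1 / (n : ℝ))) atTop
      (𝓝 (logCapacity μ.support))

/-! Adding a constant `d` that dominates `log |x - y|` on an interval containing the support makes
the kernel nonnegative, so potential theory can be done with Lebesgue integrals in `ℝ≥0∞`. Let `S`
be the support, `E` its set of nonisolated points and `b` the shifted energy of `ρ`. A measure of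
finite energy does not charge the countable set `S \ E`, so `ρ` also minimizes over `S`, and `C(S) =
exp (d - b)`.

Lower bound: by Frostman's theorem (`shiftedPotential_le_of_minimizer`) the potential of `ρ` is at
most `b` everywhere. Hence for a monic `Q` of degree `n` with roots in the interval, the integral of
`n d - log |Q|` against `ρ` is at most `n b`. As `ρ ≪ μ`, the density of `ρ` is bounded by some `N`
on a set `A` with `ρ A > η`, and Jensen's inequality on `A` gives `N ∫ Q² dμ ≥ ∫_A Q² dρ ≥ η exp (2n
(d - b / η))`. The constants vanish under `n`-th roots; then `η → 1`. This is
`exists_le_lintegral_sq_of_monic`.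

Upper bound: Fekete points of `S` give monic polynomials of size at most `exp (n (d - c) + M)` on
`S` for every `c < b` (`exists_monic_abs_eval_le`), and `P n` has the least norm among monic
polynomials of degree `n`. -/

/-! ### Shifted kernel and energy -/

/-- The logarithmic kernel shifted by `d` and truncated at zero. -/
noncomputable def shiftedKernel (d : ℝ) (x y : ℝ) : ℝ≥0∞ := (logKernel x y + (d : EReal)).toENNReal

lemma logKernel_comm {X : Type*} [MetricSpace X] (x y : X) : logKernel x y = logKernel y x := by
  simp [logKernel, edist_comm]

lemma logKernel_self {X : Type*} [MetricSpace X] (x : X) : logKernel x x = ⊤ := by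
  simp [logKernel]

lemma logKernel_of_ne {x y : ℝ} (h : x ≠ y) :
    logKernel x y = ((-Real.log |x - y| : ℝ) : EReal) := by
  have : 0 < |x - y| := abs_pos.mpr (sub_ne_zero.mpr h)
  rw [logKernel, edist_dist, Real.dist_eq, ENNReal.log_ofReal_of_pos this, EReal.coe_neg]

lemma continuous_logKernel : Continuous fun p : ℝ × ℝ => logKernel p.1 p.2 := by
  unfold logKernel
  exact (ENNReal.continuous_log.comp (continuous_fst.edist continuous_snd)).neg

lemma shiftedKernel_comm (d x y : ℝ) : shiftedKernel d x y = shiftedKernel d y x := by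
  simp [shiftedKernel, logKernel_comm]

@[simp] lemma shiftedKernel_self (d x : ℝ) : shiftedKernel d x x = ⊤ := by
  simp [shiftedKernel, logKernel_self]

lemma shiftedKernel_of_ne (d : ℝ) {x y : ℝ} (h : x ≠ y) :
    shiftedKernel d x y = ENNReal.ofReal (d - Real.log |x - y|) := by
  rw [shiftedKernel, logKernel_of_ne h, ← EReal.coe_add, EReal.toENNReal_of_ne_top (EReal.coe_ne_top _),
    EReal.toReal_coe, neg_add_eq_sub]

lemma continuous_shiftedKernel (d : ℝ) :
    Continuous fun p : ℝ × ℝ => shiftedKernel d p.1 p.2 := by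
  refine EReal.continuous_toENNReal.comp ?_
  refine continuous_iff_continuousAt.mpr fun p => ?_
  have h1 : ContinuousAt (fun q : EReal × EReal => q.1 + q.2) (logKernel p.1 p.2, (d : EReal)) :=
    EReal.continuousAt_add (Or.inr (EReal.coe_ne_bot d)) (Or.inr (EReal.coe_ne_top d))
  exact ContinuousAt.comp (f := fun p : ℝ × ℝ => (logKernel p.1 p.2, (d : EReal))) h1
    (continuous_logKernel.prodMk continuous_const).continuousAt

lemma measurable_shiftedKernel (d : ℝ) :
    Measurable fun p : ℝ × ℝ => shiftedKernel d p.1 p.2 := (continuous_shiftedKernel d).measurable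

lemma measurable_shiftedKernel_left (d x : ℝ) : Measurable fun y : ℝ => shiftedKernel d x y :=
  Measurable.comp (g := fun p : ℝ × ℝ => shiftedKernel d p.1 p.2) (f := fun y : ℝ => (x, y))
    (measurable_shiftedKernel d) measurable_prodMk_left

/-- The double integral of the shifted kernel. -/
noncomputable def shiftedEnergy (d : ℝ) (ν : Measure ℝ) : ℝ≥0∞ :=
  ∫⁻ x, ∫⁻ y, shiftedKernel d x y ∂ν ∂ν

/-- The potential of a measure with respect to the shifted kernel. -/
noncomputable def shiftedPotential (d : ℝ) (ν : Measure ℝ) (x : ℝ) : ℝ≥0∞ :=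
  ∫⁻ y, shiftedKernel d x y ∂ν

lemma measurable_shiftedPotential (d : ℝ) (ν : Measure ℝ) [SFinite ν] :
    Measurable (shiftedPotential d ν) :=
  (measurable_shiftedKernel d).lintegral_prod_right'

/-- This is `k⁺ + d = (k + d) + k⁻`, arranged without subtraction so that it survives integration in
`ℝ≥0∞` even when the energy is infinite. -/
lemma logKernel_toENNReal_add_ofReal {d x y : ℝ} (hd : 0 ≤ d) (hxy : x ≠ y → Real.log |x - y| ≤ d) :
    (logKernel x y).toENNReal + ENNReal.ofReal d =
      shiftedKernel d x y + (-logKernel x y).toENNReal := by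
  by_cases h : x = y
  · subst h; simp [logKernel_self]
  · rw [shiftedKernel_of_ne d h, logKernel_of_ne h, ← EReal.coe_neg,
      EReal.toENNReal_of_ne_top (by simp), EReal.toENNReal_of_ne_top (by simp), EReal.toReal_coe,
      EReal.toReal_coe, neg_neg]
    have := hxy h
    rcases le_total 0 (Real.log |x - y|) with h0 | h0
    · rw [ENNReal.ofReal_of_nonpos (by linarith : -Real.log |x - y| ≤ 0), zero_add,
        ← ENNReal.ofReal_add (by linarith) h0, sub_add_cancel]
    · rw [ENNReal.ofReal_of_nonpos h0, add_zero, ← ENNReal.ofReal_add (by linarith) hd]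
      congr 1; ring

lemma neg_logKernel_toENNReal_le {d x y : ℝ}
    (hxy : x ≠ y → Real.log |x - y| ≤ d) : (-logKernel x y).toENNReal ≤ ENNReal.ofReal d := by
  by_cases h : x = y
  · subst h; simp [logKernel_self]
  · rw [logKernel_of_ne h, ← EReal.coe_neg, EReal.toENNReal_of_ne_top (by simp), EReal.toReal_coe,
      neg_neg]
    exact ENNReal.ofReal_le_ofReal (hxy h)

/-- The negative part integrates to at most `d`, so the difference defining `logEnergy` is never `∞
- ∞`; since `ν` has mass one, the shift contributes exactly `d`. -/
lemma logEnergy_add_eq_shiftedEnergy {d : ℝ} (hd : 0 ≤ d) {K : Set ℝ}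
    (hK : ∀ x ∈ K, ∀ y ∈ K, x ≠ y → Real.log |x - y| ≤ d) {ν : Measure ℝ} (hν : ν ∈ probOn K) :
    logEnergy ν + d = shiftedEnergy d ν := by
  obtain ⟨hprob, hsupp⟩ := hν
  have hae : ∀ᵐ x ∂ν, x ∈ K := by rw [ae_iff]; exact hsupp
  have hfin : (∫⁻ x, ∫⁻ y, (-logKernel x y).toENNReal ∂ν ∂ν) ≤ ENNReal.ofReal d := by
    calc (∫⁻ x, ∫⁻ y, (-logKernel x y).toENNReal ∂ν ∂ν)
        ≤ ∫⁻ x, ∫⁻ y, ENNReal.ofReal d ∂ν ∂ν := by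
          refine lintegral_mono_ae ?_
          filter_upwards [hae] with x hx
          refine lintegral_mono_ae ?_
          filter_upwards [hae] with y hy
          exact neg_logKernel_toENNReal_le (hK x hx y hy)
      _ = _ := by simp
  have hadd : (∫⁻ x, ∫⁻ y, (logKernel x y).toENNReal ∂ν ∂ν) + ENNReal.ofReal d =
      shiftedEnergy d ν + ∫⁻ x, ∫⁻ y, (-logKernel x y).toENNReal ∂ν ∂ν := by
    have e1 : (∫⁻ x, ∫⁻ y, ((logKernel x y).toENNReal + ENNReal.ofReal d) ∂ν ∂ν) =
        ∫⁻ x, ∫⁻ y, (shiftedKernel d x y + (-logKernel x y).toENNReal) ∂ν ∂ν := by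
      refine lintegral_congr_ae ?_
      filter_upwards [hae] with x hx
      refine lintegral_congr_ae ?_
      filter_upwards [hae] with y hy
      exact logKernel_toENNReal_add_ofReal hd (hK x hx y hy)
    have e2 : ∀ x, (∫⁻ y, ((logKernel x y).toENNReal + ENNReal.ofReal d) ∂ν) =
        (∫⁻ y, (logKernel x y).toENNReal ∂ν) + ENNReal.ofReal d := fun x => by
      rw [lintegral_add_right _ measurable_const]; simp
    have e3 : ∀ x, (∫⁻ y, (shiftedKernel d x y + (-logKernel x y).toENNReal) ∂ν) =
        (∫⁻ y, shiftedKernel d x y ∂ν) + ∫⁻ y, (-logKernel x y).toENNReal ∂ν := fun x =>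
      lintegral_add_left (measurable_shiftedKernel_left d x) _
    simp_rw [e2, e3] at e1
    rw [lintegral_add_right _ measurable_const,
      lintegral_add_left (f := fun x => ∫⁻ y, shiftedKernel d x y ∂ν)
        (measurable_shiftedPotential d ν)] at e1
    simpa [shiftedEnergy] using e1
  rw [logEnergy]
  generalize (∫⁻ x, ∫⁻ y, (logKernel x y).toENNReal ∂ν ∂ν) = a at *
  generalize (∫⁻ x, ∫⁻ y, (-logKernel x y).toENNReal ∂ν ∂ν) = b at *
  generalize shiftedEnergy d ν = c at *
  have hb : b ≠ ⊤ := (hfin.trans_lt ENNReal.ofReal_lt_top).ne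
  lift b to NNReal using hb
  by_cases ha : a = ⊤
  · subst ha
    have : c = ⊤ := by
      by_contra hc
      simp at hadd
      exact absurd hadd.symm (by simp [hc])
    subst this
    simp
  · have hc : c ≠ ⊤ := by
      rintro rfl
      simp [ha] at hadd
    lift a to NNReal using ha
    lift c to NNReal using hc
    have : (a : ℝ) + d = c + b := by
      have := congrArg ENNReal.toReal hadd
      rw [ENNReal.toReal_add (by simp) (by simp), ENNReal.toReal_add (by simp) (by simp)] at this
      simpa [hd] using this
    have h2 : (a : ℝ) - b + d = c := by linarith
    show (((a : ℝ) : EReal)) - ((b : ℝ) : EReal) + (d : EReal) = ((c : ℝ) : EReal)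
    exact_mod_cast h2

/-! ### Atoms, isolated points, lower semicontinuity -/

lemma measurable_shiftedKernel_right (d y : ℝ) : Measurable fun x : ℝ => shiftedKernel d x y := by
  simpa only [shiftedKernel_comm d _ y] using measurable_shiftedKernel_left d y

/-- The kernel is `∞` on the diagonal, so an atom alone contributes `∞ · ν {x}²`. -/
lemma measure_singleton_of_shiftedEnergy_ne_top {d : ℝ} {ν : Measure ℝ}
    (h : shiftedEnergy d ν ≠ ⊤) (x : ℝ) : ν {x} = 0 := by
  by_contra hx
  apply h
  rw [eq_top_iff]
  calc ⊤ = ⊤ * ν {x} * ν {x} := by rw [ENNReal.top_mul hx, ENNReal.top_mul hx]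
    _ = ∫⁻ u in {x}, ∫⁻ y in {x}, shiftedKernel d u y ∂ν ∂ν := by
        simp [mul_comm, mul_left_comm]
    _ ≤ ∫⁻ u, ∫⁻ y in {x}, shiftedKernel d u y ∂ν ∂ν := setLIntegral_le_lintegral _ _
    _ ≤ _ := lintegral_mono fun u => setLIntegral_le_lintegral _ _

/-- A set of reals has only countably many isolated points. -/
lemma countable_diff_accPt (S : Set ℝ) : (S \ {x | x ∈ S ∧ AccPt x (𝓟 S)}).Countable := by
  set Y := S \ {x | x ∈ S ∧ AccPt x (𝓟 S)}
  have : DiscreteTopology Y := by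
    refine discreteTopology_subtype_iff.mpr fun x hx => ?_
    by_contra h
    exact hx.2 ⟨hx.1, (show AccPt x (𝓟 Y) from ⟨h⟩).mono
      (Filter.principal_mono.mpr Set.sdiff_subset)⟩
  exact TopologicalSpace.separableSpace_iff_countable.mp inferInstance

lemma isCompact_accPt {S : Set ℝ} (hS : IsCompact S) : IsCompact {x | x ∈ S ∧ AccPt x (𝓟 S)} := by
  have : {x | x ∈ S ∧ AccPt x (𝓟 S)} = derivedSet S := by
    ext x
    exact ⟨fun h => h.2, fun h => ⟨(isClosed_iff_derivedSet_subset S).mp hS.isClosed h, h⟩⟩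
  rw [this]
  exact hS.of_isClosed_subset (isClosed_derivedSet S)
    ((isClosed_iff_derivedSet_subset S).mp hS.isClosed)

/-- Lower semicontinuity of the potential, from Fatou's lemma and continuity of the kernel. -/
lemma isClosed_shiftedPotential_le (d : ℝ) (ν : Measure ℝ) (c : ℝ≥0∞) :
    IsClosed {x | shiftedPotential d ν x ≤ c} := by
  refine IsSeqClosed.isClosed fun u x hu hx => ?_
  calc shiftedPotential d ν x = ∫⁻ y, liminf (fun n => shiftedKernel d (u n) y) atTop ∂ν := by
        refine lintegral_congr fun y => ?_
        refine (Tendsto.liminf_eq ?_).symm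
        exact ((continuous_shiftedKernel d).comp (Continuous.prodMk_left y)).continuousAt.tendsto.comp hx
    _ ≤ liminf (fun n => ∫⁻ y, shiftedKernel d (u n) y ∂ν) atTop :=
        lintegral_liminf_le fun n => measurable_shiftedKernel_left d (u n)
    _ ≤ liminf (fun _ : ℕ => c) atTop := by
        refine liminf_le_liminf (Eventually.of_forall hu)
    _ = c := by simp

/-! ### Frostman's theorem and the maximum principle -/

lemma lintegral_shiftedPotential_comm (d : ℝ) (ν κ : Measure ℝ) [SFinite ν] [SFinite κ] :
    ∫⁻ x, shiftedPotential d ν x ∂κ = ∫⁻ x, shiftedPotential d κ x ∂ν := by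
  unfold shiftedPotential
  rw [lintegral_lintegral_swap (measurable_shiftedKernel d).aemeasurable]
  simp_rw [fun x y => shiftedKernel_comm d x y]

lemma shiftedEnergy_eq (d : ℝ) (ν : Measure ℝ) :
    shiftedEnergy d ν = ∫⁻ x, shiftedPotential d ν x ∂ν := rfl

lemma shiftedPotential_add_smul (d : ℝ) (ν κ : Measure ℝ) (s : ℝ≥0∞) (x : ℝ) :
    shiftedPotential d (ν + s • κ) x = shiftedPotential d ν x + s * shiftedPotential d κ x := by
  simp [shiftedPotential, lintegral_add_measure]

lemma shiftedEnergy_add_smul (d : ℝ) (ν κ : Measure ℝ) [SFinite ν] [SFinite κ] (s : ℝ≥0∞) :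
    shiftedEnergy d (ν + s • κ) = shiftedEnergy d ν +
      2 * s * ∫⁻ x, shiftedPotential d ν x ∂κ + s ^ 2 * shiftedEnergy d κ := by
  have m1 := measurable_shiftedPotential d ν
  have m2 := measurable_shiftedPotential d κ
  simp_rw [shiftedEnergy_eq, shiftedPotential_add_smul]
  rw [lintegral_add_left m1, lintegral_const_mul _ m2, lintegral_add_measure,
    lintegral_add_measure, lintegral_smul_measure, lintegral_smul_measure,
    lintegral_shiftedPotential_comm d κ ν, smul_eq_mul, smul_eq_mul]
  ring

lemma shiftedEnergy_smul (d : ℝ) (ν : Measure ℝ) [SFinite ν] (s : ℝ≥0∞) :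
    shiftedEnergy d (s • ν) = s ^ 2 * shiftedEnergy d ν := by
  have := shiftedEnergy_add_smul d 0 ν s
  simpa [shiftedEnergy, shiftedPotential] using this

/-- The potential of an energy minimizer is almost everywhere at least the energy. -/
lemma ae_le_shiftedPotential_of_minimizer {d : ℝ} {E : Set ℝ} {ρ : Measure ℝ} (hρ : ρ ∈ probOn E)
    (hmin : ∀ ν ∈ probOn E, shiftedEnergy d ρ ≤ shiftedEnergy d ν)
    (hfin : shiftedEnergy d ρ ≠ ⊤) :
    ∀ᵐ x ∂ρ, shiftedEnergy d ρ ≤ shiftedPotential d ρ x := by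
  obtain ⟨hprob, hsupp⟩ := hρ
  set I := shiftedEnergy d ρ
  have key : ∀ c < I, ρ {x | shiftedPotential d ρ x ≤ c} = 0 := by
    intro c hc
    set B := {x | shiftedPotential d ρ x ≤ c}
    have hBm : MeasurableSet B := (isClosed_shiftedPotential_le d ρ c).measurableSet
    by_contra hβ
    set β := ρ B with hβdef
    have hβ1 : β ≤ 1 := prob_le_one
    have hβt : β ≠ ⊤ := (hβ1.trans_lt ENNReal.one_lt_top).ne
    have hJ : shiftedEnergy d (ρ.restrict B) ≤ I :=
      lintegral_mono' Measure.restrict_le_self fun x =>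
        lintegral_mono' Measure.restrict_le_self le_rfl
    have hU : ∫⁻ x, shiftedPotential d ρ x ∂(ρ.restrict B) ≤ c * β := by
      calc _ ≤ ∫⁻ x in B, c ∂ρ := setLIntegral_mono measurable_const fun x hx => hx
        _ = _ := by simp [hβdef]
    -- Variation of `ρ` by extra mass `s` times its part on `B`. The competitor is normalized by `m
    -- = 1 + s β`, and the energy is homogeneous of degree two.
    have hs : ∀ s : NNReal, (1 + s * β) ^ 2 * I ≤ I + 2 * s * (c * β) + s ^ 2 * I := by
      intro s
      set m := 1 + s * β
      have hm0 : m ≠ 0 := by simp [m]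
      have hmt : m ≠ ⊤ := by simp [m, ENNReal.mul_eq_top, hβt]
      have hmem : m⁻¹ • (ρ + (s : ℝ≥0∞) • ρ.restrict B) ∈ probOn E := by
        refine ⟨⟨?_⟩, ?_⟩
        · simp only [Measure.smul_apply, Measure.add_apply, measure_univ, smul_eq_mul,
            Measure.restrict_apply_univ]
          exact ENNReal.inv_mul_cancel hm0 hmt
        · have : (ρ.restrict B) Eᶜ = 0 := le_antisymm
            ((Measure.restrict_le_self _).trans hsupp.le) (zero_le)
          simp [this, hsupp]
      have h1 := hmin _ hmem
      rw [shiftedEnergy_smul, shiftedEnergy_add_smul] at h1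
      calc m ^ 2 * I ≤ m ^ 2 * (m⁻¹ ^ 2 * (I + 2 * s * ∫⁻ x, shiftedPotential d ρ x ∂ρ.restrict B
              + s ^ 2 * shiftedEnergy d (ρ.restrict B))) := by gcongr
        _ = I + 2 * s * ∫⁻ x, shiftedPotential d ρ x ∂ρ.restrict B
              + s ^ 2 * shiftedEnergy d (ρ.restrict B) := by
            rw [← mul_assoc, ← mul_pow, ENNReal.mul_inv_cancel hm0 hmt, one_pow, one_mul]
        _ ≤ _ := by gcongr
    have hct : c ≠ ⊤ := hc.ne_top
    lift c to NNReal using hct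
    obtain ⟨b, hb⟩ : ∃ b : NNReal, (b : ℝ≥0∞) = β := ⟨_, ENNReal.coe_toNNReal hβt⟩
    obtain ⟨i, hi⟩ : ∃ i : NNReal, (i : ℝ≥0∞) = I := ⟨_, ENNReal.coe_toNNReal hfin⟩
    rw [← hb, ← hi] at hs
    rw [← hi] at hc
    have hc' : (c : ℝ) < i := by exact_mod_cast hc
    have hb0 : (0 : ℝ) < b := by
      have : b ≠ 0 := by
        rintro rfl
        exact hβ hb.symm
      exact_mod_cast pos_iff_ne_zero.mpr this
    -- The gain is linear in `s` and the loss quadratic, so this fails for small `s`; the value `b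
    -- (i - c) / i` below makes the left side twice the right.
    have hr : ∀ s : NNReal, 2 * (s : ℝ) * b * (i - c) ≤ s ^ 2 * i := by
      intro s
      have h := hs s
      have h' : ((1 + s * b) ^ 2 * i : ℝ) ≤ i + 2 * s * (c * b) + s ^ 2 * i := by exact_mod_cast h
      have : 0 ≤ ((s : ℝ) * b) ^ 2 * i := by positivity
      nlinarith
    have hi0 : (0 : ℝ) < i := lt_of_le_of_lt c.coe_nonneg hc'
    have h := hr ⟨b * (i - c) / i, by
      have : 0 ≤ (i : ℝ) - c := by linarith
      positivity⟩
    have hx : (0 : ℝ) < b * (i - c) := mul_pos hb0 (by linarith)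
    change 2 * ((b : ℝ) * (i - c) / i) * b * (i - c) ≤ ((b : ℝ) * (i - c) / i) ^ 2 * i at h
    rw [div_pow, sq (i : ℝ), div_mul_eq_mul_div, mul_div_mul_right _ _ hi0.ne'] at h
    have h2 : 2 * (↑b * (↑i - ↑c) / ↑i) * ↑b * ((i : ℝ) - ↑c) =
      2 * ((↑b * (↑i - ↑c)) ^ 2 / ↑i) := by ring
    rw [h2] at h
    have : 0 < ((b : ℝ) * (↑i - ↑c)) ^ 2 / ↑i := by positivity
    linarith
  rcases eq_or_ne I 0 with h0 | h0
  · simp [h0]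
  obtain ⟨u, -, hu, hul⟩ := exists_seq_strictMono_tendsto' (pos_iff_ne_zero.mpr h0)
  have : ∀ᵐ x ∂ρ, ∀ n, u n < shiftedPotential d ρ x := by
    refine ae_all_iff.mpr fun n => ?_
    rw [ae_iff]
    simpa using key (u n) (hu n).2
  filter_upwards [this] with x hx
  exact le_of_tendsto' hul fun n => (hx n).le

/-- The potential has `ρ`-mean equal to the energy and is almost everywhere at least that, so it
equals the energy almost everywhere. The sublevel set is closed of full measure, hence contains the
support. -/
lemma shiftedPotential_le_of_mem_support {d : ℝ} {E : Set ℝ} {ρ : Measure ℝ} (hρ : ρ ∈ probOn E)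
    (hmin : ∀ ν ∈ probOn E, shiftedEnergy d ρ ≤ shiftedEnergy d ν)
    (hfin : shiftedEnergy d ρ ≠ ⊤) :
    ∀ x ∈ ρ.support, shiftedPotential d ρ x ≤ shiftedEnergy d ρ := by
  have hprob : IsProbabilityMeasure ρ := hρ.1
  have h := ae_le_shiftedPotential_of_minimizer hρ hmin hfin
  have h2 : (fun _ => shiftedEnergy d ρ) =ᵐ[ρ] shiftedPotential d ρ := by
    refine ae_eq_of_ae_le_of_lintegral_le h (by simpa using hfin)
      (measurable_shiftedPotential d ρ).aemeasurable ?_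
    simp [shiftedEnergy_eq]
  exact Measure.support_subset_of_isClosed (isClosed_shiftedPotential_le d ρ _)
    (h2.mono fun x hx => hx.ge)

lemma shiftedKernel_antitone {d x y x' : ℝ} (h : |x - y| ≤ |x' - y|) :
    shiftedKernel d x' y ≤ shiftedKernel d x y := by
  unfold shiftedKernel logKernel
  refine EReal.toENNReal_le_toENNReal (add_le_add_left (EReal.neg_le_neg_iff.mpr ?_) _)
  refine ENNReal.log_le_log ?_
  rw [edist_dist, edist_dist]
  exact ENNReal.ofReal_le_ofReal h

/-- Convexity of the kernel in a gap that does not contain the second argument. -/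
lemma shiftedKernel_convex {d a b y s t : ℝ} (hy : y ≤ a ∨ b ≤ y) (hab : a < b) (hs : 0 < s)
    (ht : 0 < t) (hst : s + t = 1) :
    shiftedKernel d (s * a + t * b) y ≤
      ENNReal.ofReal s * shiftedKernel d a y + ENNReal.ofReal t * shiftedKernel d b y := by
  have hs' : ENNReal.ofReal s ≠ 0 := by simpa using hs
  have ht' : ENNReal.ofReal t ≠ 0 := by simpa using ht
  by_cases hya : a = y
  · subst hya; simp [ENNReal.mul_top hs']
  by_cases hyb : b = y
  · subst hyb; simp [ENNReal.mul_top ht']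
  -- All three points lie strictly on the same side of `y`, so the distance to `y` is affine and
  -- concavity of `log` applies.
  have hd : 0 < (s * a + t * b - y) * (b - y) ∧ 0 < (a - y) * (b - y) := by
    obtain rfl : s = 1 - t := by linarith
    rcases hy with hy | hy
    · have h1 : 0 < a - y := sub_pos.mpr (lt_of_le_of_ne hy (Ne.symm hya))
      have h2 : 0 < b - y := by linarith
      have := mul_pos ht (sub_pos.mpr hab)
      exact ⟨mul_pos (by linarith) h2, mul_pos h1 h2⟩
    · have h1 : b - y < 0 := sub_neg.mpr (lt_of_le_of_ne hy hyb)
      have := mul_pos hs (sub_pos.mpr hab)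
      exact ⟨mul_pos_of_neg_of_neg (by linarith) h1, mul_pos_of_neg_of_neg (by linarith) h1⟩
  have hb0 : b - y ≠ 0 := fun h => by simp [h] at hd
  have ha0 : a - y ≠ 0 := fun h => by simp [h] at hd
  have hc0 : s * a + t * b - y ≠ 0 := fun h => by simp [h] at hd
  have habs : |s * a + t * b - y| = s * |a - y| + t * |b - y| := by
    have e : s * a + t * b - y = s * (a - y) + t * (b - y) := by
      linear_combination y * hst
    rcases hb0.lt_or_gt with h | h
    · have h1 : a - y < 0 := by nlinarith [hd.2]
      rw [e, abs_of_neg h1, abs_of_neg h, abs_of_neg (by nlinarith)]; ring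
    · have h1 : 0 < a - y := by nlinarith [hd.2]
      rw [e, abs_of_pos h1, abs_of_pos h, abs_of_pos (by positivity)]
  rw [shiftedKernel_of_ne d (sub_ne_zero.mp hc0), shiftedKernel_of_ne d hya,
    shiftedKernel_of_ne d hyb, ← ENNReal.ofReal_mul hs.le, ← ENNReal.ofReal_mul ht.le]
  refine le_trans (ENNReal.ofReal_le_ofReal ?_) ENNReal.ofReal_add_le
  have hl := strictConcaveOn_log_Ioi.concaveOn.2 (x := |a - y|) (y := |b - y|)
    (abs_pos.mpr ha0) (abs_pos.mpr hb0) hs.le ht.le hst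
  simp only [smul_eq_mul] at hl
  rw [habs]
  have : d = s * d + t * d := by rw [← add_mul, hst, one_mul]
  linarith

/-- The maximum principle for logarithmic potentials on the line. -/
lemma shiftedPotential_le_of_le_on_support {d : ℝ} {ρ : Measure ℝ} [IsProbabilityMeasure ρ]
    (hcomp : IsCompact ρ.support) {I : ℝ≥0∞}
    (h : ∀ x ∈ ρ.support, shiftedPotential d ρ x ≤ I) (x : ℝ) :
    shiftedPotential d ρ x ≤ I := by
  set T := ρ.support
  have hae : ∀ᵐ y ∂ρ, y ∈ T := Measure.support_mem_ae
  have hne : T.Nonempty := Measure.nonempty_support (IsProbabilityMeasure.ne_zero ρ)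
  by_cases hxT : x ∈ T
  · exact h x hxT
  -- Outside the hull of `T` the nearest point of `T` has larger potential. In a gap `(a, b)` of `T`
  -- the potential is convex, hence controlled by the endpoints.
  by_cases hL : (T ∩ Set.Iic x).Nonempty
  swap
  · obtain ⟨m, hm, hmin⟩ := hcomp.exists_isLeast hne
    refine le_trans ?_ (h m hm)
    refine lintegral_mono_ae ?_
    filter_upwards [hae] with y hy
    have h1 : m ≤ y := hmin hy
    have h2 : x < m := by
      by_contra h2
      exact hL ⟨m, hm, not_lt.mp h2⟩
    apply shiftedKernel_antitone
    rw [abs_of_nonpos (by linarith), abs_of_nonpos (by linarith)]; linarith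
  by_cases hR : (T ∩ Set.Ici x).Nonempty
  swap
  · obtain ⟨m, hm, hmax⟩ := hcomp.exists_isGreatest hne
    refine le_trans ?_ (h m hm)
    refine lintegral_mono_ae ?_
    filter_upwards [hae] with y hy
    have h1 : y ≤ m := hmax hy
    have h2 : m < x := by
      by_contra h2
      exact hR ⟨m, hm, not_lt.mp h2⟩
    apply shiftedKernel_antitone
    rw [abs_of_nonneg (by linarith), abs_of_nonneg (by linarith)]; linarith
  obtain ⟨a, ⟨haT, hax⟩, hamax⟩ := (hcomp.inter_right isClosed_Iic).exists_isGreatest hL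
  obtain ⟨b, ⟨hbT, hbx⟩, hbmin⟩ := (hcomp.inter_right isClosed_Ici).exists_isLeast hR
  have hax' : a < x := lt_of_le_of_ne hax fun e => hxT (e ▸ haT)
  have hbx' : x < b := lt_of_le_of_ne hbx fun e => hxT (e ▸ hbT)
  set s := (b - x) / (b - a)
  set t := (x - a) / (b - a)
  have hba : 0 < b - a := by linarith
  have hs : 0 < s := div_pos (by linarith) hba
  have ht : 0 < t := div_pos (by linarith) hba
  have hst : s + t = 1 := by
    rw [← add_div, div_eq_one_iff_eq hba.ne']; ring
  have hx : x = s * a + t * b := by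
    simp only [s, t]; field_simp; ring
  calc shiftedPotential d ρ x
      ≤ ∫⁻ y, (ENNReal.ofReal s * shiftedKernel d a y +
          ENNReal.ofReal t * shiftedKernel d b y) ∂ρ := by
        refine lintegral_mono_ae ?_
        filter_upwards [hae] with y hy
        rw [hx]
        refine shiftedKernel_convex ?_ (by linarith) hs ht hst
        rcases le_total y x with h1 | h1
        · exact Or.inl (hamax ⟨hy, h1⟩)
        · exact Or.inr (hbmin ⟨hy, h1⟩)
    _ = ENNReal.ofReal s * shiftedPotential d ρ a + ENNReal.ofReal t * shiftedPotential d ρ b := by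
        have ma := measurable_shiftedKernel_left d a
        have mb := measurable_shiftedKernel_left d b
        rw [lintegral_add_left (ma.const_mul _), lintegral_const_mul _ ma,
          lintegral_const_mul _ mb]
        rfl
    _ ≤ ENNReal.ofReal s * I + ENNReal.ofReal t * I := by
        gcongr
        · exact h a haT
        · exact h b hbT
    _ = I := by rw [← add_mul, ← ENNReal.ofReal_add hs.le ht.le, hst, ENNReal.ofReal_one, one_mul]

/-- Frostman's theorem: the potential of the equilibrium measure is at most its energy. -/
theorem shiftedPotential_le_of_minimizer {d : ℝ} {E : Set ℝ} (hE : IsCompact E) {ρ : Measure ℝ}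
    (hρ : ρ ∈ probOn E) (hmin : ∀ ν ∈ probOn E, shiftedEnergy d ρ ≤ shiftedEnergy d ν)
    (hfin : shiftedEnergy d ρ ≠ ⊤) (x : ℝ) : shiftedPotential d ρ x ≤ shiftedEnergy d ρ := by
  have hprob : IsProbabilityMeasure ρ := hρ.1
  have hsub : ρ.support ⊆ E := Measure.support_subset_of_isClosed hE.isClosed hρ.2
  exact shiftedPotential_le_of_le_on_support
    (hE.of_isClosed_subset Measure.isClosed_support hsub)
    (shiftedPotential_le_of_mem_support hρ hmin hfin) x

/-! ### Lower bound for monic polynomials -/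

/-- An absolutely continuous probability measure is dominated by a multiple of the reference
measure on a set of almost full measure. -/
lemma exists_lintegral_restrict_le {α : Type*} [MeasurableSpace α] {μ ρ : Measure α}
    [SigmaFinite μ] [IsProbabilityMeasure ρ] (hac : ρ ≪ μ) {η : ℝ≥0∞} (hη : η < 1) :
    ∃ (N : ℕ) (A : Set α), MeasurableSet A ∧ η < ρ A ∧
      ∀ g : α → ℝ≥0∞, Measurable g → ∫⁻ x in A, g x ∂ρ ≤ N * ∫⁻ x, g x ∂μ := by
  set f := ρ.rnDeriv μ
  have hf : Measurable f := Measure.measurable_rnDeriv ρ μ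
  have hρ : μ.withDensity f = ρ := Measure.withDensity_rnDeriv_eq ρ μ hac
  -- Sublevel sets of the density; they increase to a set of full measure since the density is
  -- finite almost everywhere.
  set A : ℕ → Set α := fun N => {x | f x ≤ N}
  have hA : ∀ N, MeasurableSet (A N) := fun N => hf measurableSet_Iic
  have hmono : Monotone A := fun m n hmn x (hx : f x ≤ m) =>
    hx.trans (by exact_mod_cast hmn : (m : ℝ≥0∞) ≤ n)
  have hU : ρ (⋃ N, A N) = 1 := by
    rw [← prob_compl_eq_zero_iff (MeasurableSet.iUnion hA)]
    have h1 : μ (⋃ N, A N)ᶜ = 0 := by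
      refine measure_mono_null ?_ (ae_iff.mp (Measure.rnDeriv_lt_top ρ μ))
      intro x hx hlt
      obtain ⟨N, hN⟩ := ENNReal.exists_nat_gt hlt.ne
      exact hx (Set.mem_iUnion.mpr ⟨N, hN.le⟩)
    exact hac h1
  have ht := tendsto_measure_iUnion_atTop (μ := ρ) hmono
  rw [hU] at ht
  obtain ⟨N, hN⟩ := (ht.eventually_const_lt hη).exists
  refine ⟨N, A N, hA N, hN, fun g hg => ?_⟩
  calc ∫⁻ x in A N, g x ∂ρ = ∫⁻ x in A N, (f * g) x ∂μ := by
        conv_lhs => rw [← hρ]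
        exact setLIntegral_withDensity_eq_setLIntegral_mul μ hf hg (hA N)
    _ ≤ ∫⁻ x in A N, N * g x ∂μ :=
        setLIntegral_mono (hg.const_mul _) fun x hx => mul_le_mul_left hx (g x)
    _ ≤ ∫⁻ x, N * g x ∂μ := setLIntegral_le_lintegral _ _
    _ = _ := lintegral_const_mul _ hg

/-- Projecting a complex root to the line and then to the interval brings it no farther from any
point of the interval. -/
lemma abs_sub_clamp_le {R x : ℝ} (hx : x ∈ Set.Icc (-R) R) (w : ℂ) :
    |x - max (-R) (min R w.re)| ≤ ‖(x : ℂ) - w‖ := by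
  have h : |x - w.re| ≤ ‖(x : ℂ) - w‖ := by simpa using Complex.abs_re_le_norm ((x : ℂ) - w)
  refine le_trans ?_ h
  obtain ⟨h1, h2⟩ := hx
  rcases le_total R w.re with h3 | h3
  · rw [min_eq_left h3, max_eq_right (by linarith), abs_of_nonpos (by linarith),
      abs_of_nonpos (by linarith)]; linarith
  · rw [min_eq_right h3]
    rcases le_total (-R) w.re with h4 | h4
    · rw [max_eq_right h4]
    · rw [max_eq_left h4, abs_of_nonneg (by linarith), abs_of_nonneg (by linarith)]; linarith

/-- On an interval, a monic polynomial dominates one with all its roots in the interval. -/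
lemma Polynomial.Monic.exists_prod_abs_sub_le {R : ℝ} (hR : 0 ≤ R) {Q : ℝ[X]} (hQ : Q.Monic) :
    ∃ z : Fin Q.natDegree → ℝ, (∀ i, z i ∈ Set.Icc (-R) R) ∧
      ∀ x ∈ Set.Icc (-R) R, ∏ i, |x - z i| ≤ |Q.eval x| := by
  have hs := IsAlgClosed.splits (Q.map (algebraMap ℝ ℂ))
  have hcard : (Q.map (algebraMap ℝ ℂ)).roots.toList.length = Q.natDegree := by
    rw [Multiset.length_toList, ← hs.natDegree_eq_card_roots, hQ.natDegree_map]
  set l := (Q.map (algebraMap ℝ ℂ)).roots.toList with hl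
  have hev : ∀ x : ℝ, (l.map fun w => ‖(x : ℂ) - w‖).prod = |Q.eval x| := by
    intro x
    have h1 : (Q.map (algebraMap ℝ ℂ)).eval (x : ℂ) = ((Q.eval x : ℝ) : ℂ) := by
      have := eval_map_algebraMap (B := ℂ) Q (x : ℂ)
      rw [this]
      exact aeval_algebraMap_apply ℂ x Q
    have h2 := hs.eq_prod_roots_of_monic (hQ.map _)
    have h3 : (Q.map (algebraMap ℝ ℂ)).eval (x : ℂ) = (l.map fun w => (x : ℂ) - w).prod := by
      conv_lhs => rw [h2]
      rw [eval_multiset_prod, Multiset.map_map, ← Multiset.coe_toList (roots _), ← hl,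
        Multiset.map_coe, Multiset.prod_coe]
      simp [Function.comp_def]
    rw [← Real.norm_eq_abs, ← Complex.norm_real, ← h1, h3]
    clear_value l
    clear hcard hl h3
    induction l with
    | nil => simp
    | cons a l ih => simp [ih]
  clear_value l
  rw [← hcard]
  refine ⟨fun i => max (-R) (min R (l.get i).re), fun i => ⟨le_max_left _ _,
    max_le (by linarith) (min_le_left _ _)⟩, fun x hx => ?_⟩
  rw [← hev x]
  have : (l.map fun w => ‖(x : ℂ) - w‖).prod = ∏ i : Fin l.length, ‖(x : ℂ) - l.get i‖ := by
    rw [← List.prod_ofFn]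
    congr 1
    apply List.ext_get <;> simp
  rw [this]
  exact Finset.prod_le_prod (fun i _ => abs_nonneg _) fun i _ => abs_sub_clamp_le hx _

/-- As `d` dominates the logarithm, the truncation at zero is inactive and the kernel determines the
distance. -/
lemma abs_sub_eq_exp {d x z : ℝ} (hxz : x ≠ z → Real.log |x - z| ≤ d)
    (h : shiftedKernel d x z ≠ ⊤) : |x - z| = Real.exp (d - (shiftedKernel d x z).toReal) := by
  have hne : x ≠ z := by rintro rfl; simp at h
  rw [shiftedKernel_of_ne d hne, ENNReal.toReal_ofReal (by linarith [hxz hne]), sub_sub_cancel,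
    Real.exp_log (abs_pos.mpr (sub_ne_zero.mpr hne))]

/-- Jensen's inequality for the exponential of a nonnegative function of bounded integral. -/
lemma ofReal_mul_exp_le_lintegral {α : Type*} [MeasurableSpace α] {ν : Measure α}
    [IsFiniteMeasure ν] {H : α → ℝ≥0∞} (hH : Measurable H) {a b C : ℝ} (ha : 0 < a)
    (haν : a ≤ ν.real Set.univ) (hb : 0 ≤ b) (hint : ∫⁻ x, H x ∂ν ≤ ENNReal.ofReal b) :
    ENNReal.ofReal (a * Real.exp (C - 2 * b / a)) ≤
      ∫⁻ x, ENNReal.ofReal (Real.exp (C - 2 * (H x).toReal)) ∂ν := by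
  set h := fun x => (H x).toReal
  have hi : Integrable h ν := integrable_toReal_of_lintegral_ne_top hH.aemeasurable
    (hint.trans_lt ENNReal.ofReal_lt_top).ne
  have hbd : ∫ x, h x ∂ν ≤ b := by
    rw [integral_toReal hH.aemeasurable
      (ae_lt_top hH (hint.trans_lt ENNReal.ofReal_lt_top).ne)]
    exact ENNReal.toReal_le_of_le_ofReal hb hint
  have hm : Measurable h := hH.ennreal_toReal
  have hexp : Integrable (fun x => Real.exp (C - 2 * h x)) ν := by
    refine Integrable.of_bound (by fun_prop) (Real.exp C) (Eventually.of_forall fun x => ?_)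
    rw [Real.norm_eq_abs, Real.abs_exp]
    exact Real.exp_le_exp.mpr (by linarith [ENNReal.toReal_nonneg (a := H x)])
  rw [← ofReal_integral_eq_lintegral_ofReal hexp (Eventually.of_forall fun x => (Real.exp_pos _).le)]
  refine ENNReal.ofReal_le_ofReal ?_
  set m := b / a
  -- Tangent line of the exponential at `C - 2 m`. Here `m = b / a` only bounds the mean of `h` from
  -- above, which suffices as the mass is at least `a`.
  have hpt : ∀ x, Real.exp (C - 2 * m) * (1 - 2 * (h x - m)) ≤ Real.exp (C - 2 * h x) := by
    intro x
    have h1 : C - 2 * h x = (C - 2 * m) + (-2 * (h x - m)) := by ring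
    rw [h1, Real.exp_add]
    have := Real.add_one_le_exp (-2 * (h x - m))
    gcongr
    linarith
  have hint2 : Integrable (fun x => Real.exp (C - 2 * m) * (1 - 2 * (h x - m))) ν := by
    fun_prop
  have hmono := integral_mono hint2 hexp hpt
  refine le_trans ?_ hmono
  have e : ∫ x, Real.exp (C - 2 * m) * (1 - 2 * (h x - m)) ∂ν =
      Real.exp (C - 2 * m) * (ν.real Set.univ * (1 + 2 * m) - 2 * ∫ x, h x ∂ν) := by
    rw [integral_const_mul]
    congr 1
    have : ∀ x, 1 - 2 * (h x - m) = (1 + 2 * m) - 2 * h x := fun x => by ring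
    simp_rw [this]
    rw [integral_sub (integrable_const _) (hi.const_mul 2), integral_const, integral_const_mul,
      smul_eq_mul]
  rw [e, mul_comm a, mul_div_assoc]
  gcongr
  have hm0 : 0 ≤ m := div_nonneg hb ha.le
  have hma : m * a = b := div_mul_cancel₀ _ ha.ne'
  nlinarith

/-- Lower bound for the `L²` norms of monic polynomials in terms of the potential of an absolutely
continuous measure. -/
theorem exists_le_lintegral_sq_of_monic {μ ρ : Measure ℝ} [SigmaFinite μ] [IsProbabilityMeasure ρ]
    (hac : ρ ≪ μ) {R d b η : ℝ} (hR : 0 ≤ R) (hρ : ρ (Set.Icc (-R) R)ᶜ = 0)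
    (hd : ∀ x ∈ Set.Icc (-R) R, ∀ y ∈ Set.Icc (-R) R, x ≠ y → Real.log |x - y| ≤ d)
    (hb : 0 ≤ b) (hpot : ∀ x, shiftedPotential d ρ x ≤ ENNReal.ofReal b)
    (hη : 0 < η) (hη1 : η < 1) :
    ∃ κ : ℝ, 0 < κ ∧ ∀ Q : ℝ[X], Q.Monic →
      ENNReal.ofReal (κ * Real.exp (2 * Q.natDegree * (d - b / η))) ≤
        ∫⁻ x, ‖Q.eval x‖ₑ ^ 2 ∂μ := by
  obtain ⟨N, A, hA, hηA, hN⟩ := exists_lintegral_restrict_le hac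
    (η := ENNReal.ofReal η) (by simpa using hη1)
  have hηA' : η ≤ (ρ.restrict A).real Set.univ := by
    rw [measureReal_restrict_apply_univ]
    exact (ENNReal.ofReal_le_iff_le_toReal (measure_ne_top _ _)).mp hηA.le
  -- `N` is the domination constant on `A`; `N + 1` keeps the denominator positive.
  refine ⟨η / (N + 1), by positivity, fun Q hQ => ?_⟩
  set n := Q.natDegree
  obtain ⟨z, hz, hzQ⟩ : ∃ z : Fin n → ℝ, (∀ i, z i ∈ Set.Icc (-R) R) ∧
    ∀ x ∈ Set.Icc (-R) R, ∏ i, |x - z i| ≤ |Q.eval x| := hQ.exists_prod_abs_sub_le hR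
  set H : ℝ → ℝ≥0∞ := fun x => ∑ i, shiftedKernel d x (z i)
  have hH : Measurable H := Finset.measurable_fun_sum _ fun i _ =>
    measurable_shiftedKernel_right d (z i)
  -- Nonnegativity of the shifted kernel allows enlarging `A` to the whole line, where the Frostman
  -- bound holds at each root.
  have hHint : ∫⁻ x in A, H x ∂ρ ≤ ENNReal.ofReal (n * b) := by
    calc ∫⁻ x in A, H x ∂ρ ≤ ∫⁻ x, H x ∂ρ := setLIntegral_le_lintegral _ _
      _ = ∑ i, ∫⁻ x, shiftedKernel d x (z i) ∂ρ :=
          lintegral_finsetSum _ fun i _ => measurable_shiftedKernel_right d (z i)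
      _ ≤ ∑ i : Fin n, ENNReal.ofReal b := by
          refine Finset.sum_le_sum fun i _ => ?_
          simp_rw [shiftedKernel_comm d _ (z i)]
          exact hpot (z i)
      _ = _ := by
          rw [Finset.sum_const, Finset.card_univ, Fintype.card_fin, nsmul_eq_mul,
            ENNReal.ofReal_mul (by positivity), ENNReal.ofReal_natCast]
  have hJ := ofReal_mul_exp_le_lintegral (C := 2 * n * d) hH hη hηA' (by positivity) hHint
  have hae : ∀ᵐ x ∂(ρ.restrict A), x ∈ Set.Icc (-R) R :=
    ae_restrict_of_ae (by rw [ae_iff]; exact hρ)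
  have hfin : ∀ᵐ x ∂(ρ.restrict A), H x < ⊤ :=
    ae_lt_top hH (hHint.trans_lt ENNReal.ofReal_lt_top).ne
  have hle : ∫⁻ x in A, ENNReal.ofReal (Real.exp (2 * n * d - 2 * (H x).toReal)) ∂ρ ≤
      ∫⁻ x in A, ‖Q.eval x‖ₑ ^ 2 ∂ρ := by
    refine lintegral_mono_ae ?_
    filter_upwards [hae, hfin] with x hx hHx
    have hk : ∀ i, shiftedKernel d x (z i) ≠ ⊤ := fun i =>
      (ENNReal.sum_lt_top.mp hHx i (Finset.mem_univ i)).ne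
    have hp : ∏ i, |x - z i| = Real.exp (n * d - (H x).toReal) := by
      rw [Finset.prod_congr rfl fun i _ => abs_sub_eq_exp (hd x hx _ (hz i)) (hk i),
        ← Real.exp_sum, Finset.sum_sub_distrib, ENNReal.toReal_sum fun i _ => hk i]
      simp
    have h2 : 2 * n * d - 2 * (H x).toReal = 2 * (n * d - (H x).toReal) := by ring
    rw [h2, two_mul, Real.exp_add, ← hp, Real.enorm_eq_ofReal_abs, ← ENNReal.ofReal_pow
      (abs_nonneg _), ← sq]
    refine ENNReal.ofReal_le_ofReal ?_
    exact pow_le_pow_left₀ (Finset.prod_nonneg fun i _ => abs_nonneg _) (hzQ x hx) 2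
  have hQm : Measurable fun x => ‖Q.eval x‖ₑ ^ 2 :=
    Q.continuous.measurable.enorm.pow_const 2
  have htot := (hJ.trans hle).trans (hN _ hQm)
  have hN0 : (0 : ℝ) < N + 1 := by positivity
  have hexpo : 2 * n * d - 2 * (n * b) / η = 2 * n * (d - b / η) := by ring
  rw [hexpo] at htot
  have h3 : ENNReal.ofReal (η * Real.exp (2 * n * (d - b / η))) ≤
      ENNReal.ofReal (N + 1) * ∫⁻ x, ‖Q.eval x‖ₑ ^ 2 ∂μ := by
    refine htot.trans (mul_le_mul_left ?_ _)
    rw [← ENNReal.ofReal_natCast]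
    exact ENNReal.ofReal_le_ofReal (by linarith)
  rw [div_mul_eq_mul_div, ENNReal.ofReal_div_of_pos hN0]
  exact ENNReal.div_le_of_le_mul' h3

/-! ### Truncated energies and Fekete points -/

/-- The kernel truncated from above at `M` as a bounded continuous function. -/
noncomputable def truncatedKernel (S : Set ℝ) (d : ℝ) (M : ℕ) :
    BoundedContinuousFunction (S × S) NNReal :=
  BoundedContinuousFunction.mkOfBound
    ⟨fun p => (min (shiftedKernel d p.1 p.2) (M : ℝ≥0∞)).toNNReal, by
      have h : Continuous fun p : S × S => min (shiftedKernel d p.1 p.2) (M : ℝ≥0∞) :=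
        (Continuous.comp (g := fun p : ℝ × ℝ => shiftedKernel d p.1 p.2)
          (f := fun p : S × S => ((p.1 : ℝ), (p.2 : ℝ)))
          (continuous_shiftedKernel d) (by fun_prop)).min continuous_const
      exact ENNReal.continuousOn_toNNReal.comp_continuous h
        fun p => ((min_le_right _ _).trans_lt (ENNReal.natCast_lt_top M)).ne⟩ M fun p q => by
    have h : ∀ r : S × S, (min (shiftedKernel d r.1 r.2) (M : ℝ≥0∞)).toNNReal ≤ M := fun r => by
      have := ENNReal.toNNReal_mono (ENNReal.natCast_ne_top M)
        (min_le_right (shiftedKernel d r.1 r.2) (M : ℝ≥0∞))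
      simpa using this
    have hp : (((min (shiftedKernel d p.1 p.2) (M : ℝ≥0∞)).toNNReal : NNReal) : ℝ) ≤ M := by
      exact_mod_cast h p
    have hq : (((min (shiftedKernel d q.1 q.2) (M : ℝ≥0∞)).toNNReal : NNReal) : ℝ) ≤ M := by
      exact_mod_cast h q
    rw [NNReal.dist_eq]
    refine abs_le.mpr ⟨?_, ?_⟩
    · refine le_trans (neg_le_neg hq) ?_
      simp
    · refine le_trans ?_ hp
      simp

lemma coe_truncatedKernel (S : Set ℝ) (d : ℝ) (M : ℕ) (p : S × S) :
    (truncatedKernel S d M p : ℝ≥0∞) = min (shiftedKernel d p.1 p.2) M :=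
  ENNReal.coe_toNNReal ((min_le_right _ _).trans_lt (ENNReal.natCast_lt_top M)).ne

lemma continuous_lintegral_truncatedKernel (S : Set ℝ) (d : ℝ) (M : ℕ) :
    Continuous fun ν : ProbabilityMeasure S =>
      ∫⁻ p, truncatedKernel S d M p ∂(ν.prod ν : Measure (S × S)) := by
  have h : Continuous fun ν : ProbabilityMeasure S => ν.prod ν :=
    ProbabilityMeasure.continuous_prod.comp (continuous_id.prodMk continuous_id)
  exact ProbabilityMeasure.continuous_iff_forall_continuous_lintegral.mp h _

/-- Passing to the subtype makes weak compactness of the probability measures on a compact `S`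
available. -/
lemma shiftedEnergy_map_subtype (S : Set ℝ) (hS : MeasurableSet S) (d : ℝ)
    (ν : ProbabilityMeasure S) :
    shiftedEnergy d ((ν : Measure S).map Subtype.val) =
      ∫⁻ p, shiftedKernel d p.1 p.2 ∂(ν.prod ν : Measure (S × S)) := by
  have he := MeasurableEmbedding.subtype_coe hS
  have hm : Measurable fun p : S × S => shiftedKernel d p.1 p.2 :=
    Measurable.comp (g := fun p : ℝ × ℝ => shiftedKernel d p.1 p.2)
      (f := fun p : S × S => ((p.1 : ℝ), (p.2 : ℝ))) (measurable_shiftedKernel d) (by fun_prop)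
  rw [shiftedEnergy, he.lintegral_map]
  simp_rw [he.lintegral_map]
  rw [ProbabilityMeasure.toMeasure_prod, lintegral_prod _ hm.aemeasurable]

/-- If all energies exceed `c`, so do all truncated energies at some fixed level. -/
lemma exists_lt_lintegral_truncatedKernel {S : Set ℝ} (hS : IsCompact S) {d : ℝ} {c : ℝ≥0∞}
    (hc : ∀ ν ∈ probOn S, c < shiftedEnergy d ν) :
    ∃ M : ℕ, ∀ ν : ProbabilityMeasure S,
      c < ∫⁻ p, truncatedKernel S d M p ∂(ν.prod ν : Measure (S × S)) := by
  by_contra! hcon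
  have : CompactSpace S := isCompact_iff_compactSpace.mp hS
  set F : ℕ → Set (ProbabilityMeasure S) := fun M =>
    {ν | ∫⁻ p, truncatedKernel S d M p ∂(ν.prod ν : Measure (S × S)) ≤ c}
  have hcl : ∀ M, IsClosed (F M) := fun M =>
    isClosed_le (continuous_lintegral_truncatedKernel S d M) continuous_const
  have hmono : ∀ p, Monotone fun M : ℕ => (truncatedKernel S d M p : ℝ≥0∞) := by
    intro p M N hMN
    simp only [coe_truncatedKernel]
    exact min_le_min_left _ (by exact_mod_cast hMN)
  -- A measure in all the nested compact sets `F M` has every truncated energy at most `c`, hence,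
  -- by monotone convergence, also its full energy.
  obtain ⟨ν, hν⟩ := IsCompact.nonempty_iInter_of_sequence_nonempty_isCompact_isClosed F
    (fun M ν hν => (lintegral_mono fun p => hmono p (Nat.le_succ M)).trans hν) hcon
    (hcl 0).isCompact hcl
  rw [Set.mem_iInter] at hν
  have hmem : (ν : Measure S).map Subtype.val ∈ probOn S := by
    refine ⟨Measure.isProbabilityMeasure_map measurable_subtype_coe.aemeasurable, ?_⟩
    rw [Measure.map_apply measurable_subtype_coe hS.measurableSet.compl]
    simp
  refine (hc _ hmem).not_ge ?_
  rw [shiftedEnergy_map_subtype S hS.measurableSet]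
  have hsup : ∀ p : S × S, shiftedKernel d p.1 p.2 = ⨆ M, (truncatedKernel S d M p : ℝ≥0∞) := by
    intro p
    simp only [coe_truncatedKernel]
    have h := inf_iSup_eq (shiftedKernel d p.1 p.2) (fun M : ℕ => (M : ℝ≥0∞))
    rwa [ENNReal.iSup_natCast, inf_top_eq] at h
  simp_rw [hsup]
  rw [lintegral_iSup]
  · exact iSup_le hν
  · intro M
    exact (truncatedKernel S d M).continuous.measurable.coe_nnreal_ennreal
  · intro M N hMN p
    exact hmono p hMN

/-- Each pair containing `i` occurs in both orders, hence the square; the remaining factor does not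
involve `i`, so a maximizer of the whole product is a maximizer in each coordinate. -/
lemma prod_prod_erase_eq {ι : Type*} [Fintype ι] [DecidableEq ι] (f : ι → ι → ℝ)
    (hf : ∀ a b, f a b = f b a) (i : ι) :
    ∏ a, ∏ b ∈ Finset.univ.erase a, f a b = (∏ b ∈ Finset.univ.erase i, f i b) ^ 2 *
      ∏ a ∈ Finset.univ.erase i, ∏ b ∈ (Finset.univ.erase a).erase i, f a b := by
  rw [← Finset.mul_prod_erase _ _ (Finset.mem_univ i)]
  have : ∀ a ∈ Finset.univ.erase i, ∏ b ∈ Finset.univ.erase a, f a b =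
      f i a * ∏ b ∈ (Finset.univ.erase a).erase i, f a b := by
    intro a ha
    rw [← Finset.mul_prod_erase _ _ (Finset.mem_erase.mpr
      ⟨(Finset.ne_of_mem_erase ha).symm, Finset.mem_univ i⟩), hf a i]
  rw [Finset.prod_congr rfl this, Finset.prod_mul_distrib]
  ring

/-- Existence of Fekete points. -/
lemma exists_fekete {S : Set ℝ} (hS : IsCompact S) (hinf : S.Infinite) {ι : Type*} [Fintype ι]
    [DecidableEq ι] :
    ∃ x : ι → ℝ, (∀ i, x i ∈ S) ∧ Function.Injective x ∧ ∀ i, ∀ y ∈ S,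
      ∏ j ∈ Finset.univ.erase i, |y - x j| ≤ ∏ j ∈ Finset.univ.erase i, |x i - x j| := by
  set G : (ι → ℝ) → ℝ := fun x => ∏ a, ∏ b ∈ Finset.univ.erase a, |x a - x b|
  have hGc : Continuous G := by fun_prop
  have hK : IsCompact (Set.univ.pi fun _ : ι => S) := isCompact_univ_pi fun _ => hS
  have hposinj : ∀ x, Function.Injective x → 0 < G x := fun x hx =>
    Finset.prod_pos fun a _ => Finset.prod_pos fun b hb =>
      abs_pos.mpr (sub_ne_zero.mpr fun h => Finset.ne_of_mem_erase hb (hx h).symm)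
  obtain ⟨x₀, hx₀, hx₀i⟩ : ∃ x₀ : ι → ℝ, (∀ i, x₀ i ∈ S) ∧ Function.Injective x₀ := by
    let e := hinf.natEmbedding
    let g := (Fintype.equivFin ι)
    exact ⟨fun i => e (g i), fun i => (e (g i)).2, fun a b h =>
      g.injective (Fin.val_injective (e.injective (Subtype.ext h)))⟩
  obtain ⟨x, hxS, hmax⟩ := hK.exists_isMaxOn ⟨x₀, fun i _ => hx₀ i⟩ hGc.continuousOn
  have hxS' : ∀ i, x i ∈ S := fun i => hxS i (Set.mem_univ i)
  have hGpos : 0 < G x := (hposinj x₀ hx₀i).trans_le (hmax fun i _ => hx₀ i)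
  refine ⟨x, hxS', fun a b hab => ?_, fun i y hy => ?_⟩
  · by_contra hne
    refine hGpos.ne' (Finset.prod_eq_zero (Finset.mem_univ a) (Finset.prod_eq_zero
      (Finset.mem_erase.mpr ⟨Ne.symm hne, Finset.mem_univ b⟩) ?_))
    rw [hab]; simp
  · have h1 := hmax (a := Function.update x i y) (fun j _ => by
      by_cases hj : j = i
      · subst hj; simpa using hy
      · simpa [hj] using hxS' j)
    simp only [Set.mem_ofPred_eq] at h1
    have hsym : ∀ z : ι → ℝ, ∀ a b, |z a - z b| = |z b - z a| := fun z a b => abs_sub_comm _ _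
    have e1 := prod_prod_erase_eq (fun a b => |x a - x b|) (hsym x) i
    have e2 := prod_prod_erase_eq (fun a b => |Function.update x i y a - Function.update x i y b|)
      (hsym _) i
    have e3 : ∏ b ∈ Finset.univ.erase i, |Function.update x i y i - Function.update x i y b| =
        ∏ b ∈ Finset.univ.erase i, |y - x b| :=
      Finset.prod_congr rfl fun b hb => by simp [Finset.ne_of_mem_erase hb]
    have e4 : ∏ a ∈ Finset.univ.erase i, ∏ b ∈ (Finset.univ.erase a).erase i,
        |Function.update x i y a - Function.update x i y b| =
        ∏ a ∈ Finset.univ.erase i, ∏ b ∈ (Finset.univ.erase a).erase i, |x a - x b| :=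
      Finset.prod_congr rfl fun a ha => Finset.prod_congr rfl fun b hb => by
        simp [Finset.ne_of_mem_erase ha, Finset.ne_of_mem_erase hb]
    rw [e3, e4] at e2
    set rest := ∏ a ∈ Finset.univ.erase i, ∏ b ∈ (Finset.univ.erase a).erase i, |x a - x b|
    have hrest : 0 < rest := by
      have h0 : 0 ≤ rest := Finset.prod_nonneg fun a _ => Finset.prod_nonneg fun b _ => abs_nonneg _
      refine lt_of_le_of_ne h0 fun h => ?_
      rw [← h, mul_zero] at e1
      exact hGpos.ne' e1
    have h2 : (∏ b ∈ Finset.univ.erase i, |y - x b|) ^ 2 * rest ≤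
        (∏ b ∈ Finset.univ.erase i, |x i - x b|) ^ 2 * rest := by
      rw [← e1, ← e2]; exact h1
    exact le_of_sq_le_sq (le_of_mul_le_mul_right h2 hrest)
      (Finset.prod_nonneg fun b _ => abs_nonneg _)

/-- The truncated energy of a uniform discrete measure bounds sums of the kernel off the
diagonal. -/
lemma le_sum_shiftedKernel {S : Set ℝ} {d : ℝ} {c : ℝ≥0∞} {M : ℕ}
    (hM : ∀ ν : ProbabilityMeasure S,
      c < ∫⁻ p, truncatedKernel S d M p ∂(ν.prod ν : Measure (S × S)))
    {n : ℕ} (x : Fin (n + 1) → S) :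
    (n + 1 : ℝ≥0∞) ^ 2 * c ≤ (n + 1) * M +
      ∑ i, ∑ j ∈ Finset.univ.erase i, shiftedKernel d (x i) (x j) := by
  set m : ℝ≥0∞ := n + 1
  have hm0 : m ≠ 0 := by simp [m]
  have hmt : m ≠ ⊤ := by simp [m]
  set ν₀ : Measure S := m⁻¹ • ∑ i, Measure.dirac (x i)
  have hprob : IsProbabilityMeasure ν₀ := ⟨by
    simp only [ν₀, Measure.smul_apply, Measure.finsetSum_apply, measure_univ, smul_eq_mul,
      Finset.sum_const, Finset.card_univ, Fintype.card_fin, nsmul_eq_mul, mul_one]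
    push_cast
    exact ENNReal.inv_mul_cancel hm0 hmt⟩
  have h : c ≤ ∫⁻ p, truncatedKernel S d M p ∂(ν₀.prod ν₀) := (hM ⟨ν₀, hprob⟩).le
  have hmeas : Measurable fun p : S × S => (truncatedKernel S d M p : ℝ≥0∞) :=
    (truncatedKernel S d M).continuous.measurable.coe_nnreal_ennreal
  rw [lintegral_prod _ hmeas.aemeasurable] at h
  have hint : ∀ g : S → ℝ≥0∞, Measurable g → ∫⁻ y, g y ∂ν₀ = m⁻¹ * ∑ i, g (x i) := by
    intro g hg
    simp only [ν₀, lintegral_smul_measure, lintegral_finsetSum_measure, smul_eq_mul,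
      lintegral_dirac' _ hg]
  rw [hint _ hmeas.lintegral_prod_right'] at h
  have hint' : ∀ a : S, ∫⁻ y, truncatedKernel S d M (a, y) ∂ν₀ =
      m⁻¹ * ∑ j, (truncatedKernel S d M (a, x j) : ℝ≥0∞) := fun a =>
    hint _ (hmeas.comp (measurable_prodMk_left (x := a)))
  simp_rw [hint'] at h
  rw [← Finset.mul_sum, ← mul_assoc] at h
  calc m ^ 2 * c ≤ m ^ 2 * (m⁻¹ * m⁻¹ * ∑ i, ∑ j, (truncatedKernel S d M (x i, x j) : ℝ≥0∞)) := by
        gcongr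
    _ = ∑ i, ∑ j, (truncatedKernel S d M (x i, x j) : ℝ≥0∞) := by
        rw [← mul_assoc, ← sq, ← mul_pow, ENNReal.mul_inv_cancel hm0 hmt, one_pow, one_mul]
    -- The truncation is needed only on the diagonal, where each of the `n + 1` terms costs at most
    -- `M`.
    _ ≤ ∑ i, (M + ∑ j ∈ Finset.univ.erase i, shiftedKernel d (x i) (x j)) := by
        refine Finset.sum_le_sum fun i _ => ?_
        rw [← Finset.add_sum_erase _ _ (Finset.mem_univ i)]
        simp only [coe_truncatedKernel]
        exact add_le_add (min_le_right _ _) (Finset.sum_le_sum fun j _ => min_le_left _ _)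
    _ = _ := by
        rw [Finset.sum_add_distrib]
        simp [m]

/-- Existence of monic polynomials with small supremum norm on a compact set. -/
theorem exists_monic_abs_eval_le {S : Set ℝ} (hS : IsCompact S) (hinf : S.Infinite) {d c : ℝ}
    (hd : ∀ x ∈ S, ∀ y ∈ S, x ≠ y → Real.log |x - y| ≤ d) (hc0 : 0 ≤ c)
    (hc : ∀ ν ∈ probOn S, ENNReal.ofReal c < shiftedEnergy d ν) :
    ∃ M : ℕ, ∀ n : ℕ, ∃ Q : ℝ[X], Q.Monic ∧ Q.natDegree = n ∧
      ∀ x ∈ S, |Q.eval x| ≤ Real.exp (n * (d - c) + M) := by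
  obtain ⟨M, hM⟩ := exists_lt_lintegral_truncatedKernel hS hc
  refine ⟨M, fun n => ?_⟩
  -- With `n + 1` points, all but one serve as the roots of a polynomial of degree `n`; its maximum
  -- on `S` is attained at the omitted point.
  obtain ⟨x, hxS, hxi, hx⟩ := exists_fekete hS hinf (ι := Fin (n + 1))
  have hE := le_sum_shiftedKernel hM (fun i => ⟨x i, hxS i⟩)
  have hpos : ∀ i, ∀ j ∈ Finset.univ.erase i, 0 < |x i - x j| := fun i j hj =>
    abs_pos.mpr (sub_ne_zero.mpr fun h => Finset.ne_of_mem_erase hj (hxi h).symm)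
  have hker : ∀ i, ∀ j ∈ Finset.univ.erase i,
      shiftedKernel d (x i) (x j) = ENNReal.ofReal (d - Real.log |x i - x j|) := fun i j hj =>
    shiftedKernel_of_ne d fun h => Finset.ne_of_mem_erase hj (hxi h).symm
  have hnn : ∀ i, ∀ j ∈ Finset.univ.erase i, 0 ≤ d - Real.log |x i - x j| := fun i j hj =>
    sub_nonneg.mpr (hd _ (hxS i) _ (hxS j) fun h => Finset.ne_of_mem_erase hj (hxi h).symm)
  have hsum : ∑ i, ∑ j ∈ Finset.univ.erase i, shiftedKernel d (x i) (x j) =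
      ENNReal.ofReal (∑ i, ∑ j ∈ Finset.univ.erase i, (d - Real.log |x i - x j|)) := by
    rw [ENNReal.ofReal_sum_of_nonneg fun i _ => Finset.sum_nonneg (hnn i)]
    refine Finset.sum_congr rfl fun i _ => ?_
    rw [ENNReal.ofReal_sum_of_nonneg (hnn i)]
    exact Finset.sum_congr rfl (hker i)
  have hsum0 : 0 ≤ ∑ i, ∑ j ∈ Finset.univ.erase i, (d - Real.log |x i - x j|) :=
    Finset.sum_nonneg fun i _ => Finset.sum_nonneg (hnn i)
  simp only [hsum] at hE
  have hreal : ((n : ℝ) + 1) ^ 2 * c ≤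
      (n + 1) * M + ∑ i, ∑ j ∈ Finset.univ.erase i, (d - Real.log |x i - x j|) := by
    have hn1 : (0 : ℝ) ≤ n + 1 := by positivity
    have e1 : (n + 1 : ℝ≥0∞) = ENNReal.ofReal (n + 1) := by
      rw [ENNReal.ofReal_add (by positivity) zero_le_one]; simp
    have e2 : (M : ℝ≥0∞) = ENNReal.ofReal M := by simp
    rw [e1, e2, ← ENNReal.ofReal_pow hn1, ← ENNReal.ofReal_mul (by positivity),
      ← ENNReal.ofReal_mul hn1, ← ENNReal.ofReal_add (by positivity) hsum0,
      ENNReal.ofReal_le_ofReal_iff (by positivity)] at hE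
    exact hE
  set q : Fin (n + 1) → ℝ := fun i => ∑ j ∈ Finset.univ.erase i, Real.log |x i - x j|
  have hcard : ∀ i : Fin (n + 1), (Finset.univ.erase i).card = n := fun i => by simp
  have hqs : ∑ i, ∑ j ∈ Finset.univ.erase i, (d - Real.log |x i - x j|) =
      (n + 1) * (n * d) - ∑ i, q i := by
    simp only [Finset.sum_sub_distrib, Finset.sum_const, hcard, q]
    simp
  rw [hqs] at hreal
  -- Averaging `hreal` over the points gives `n d - (n + 1) c + M`, and one `c ≥ 0` is discarded.
  obtain ⟨i, -, hi⟩ : ∃ i ∈ (Finset.univ : Finset (Fin (n + 1))), q i ≤ n * (d - c) + M := by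
    refine Finset.exists_le_of_sum_le Finset.univ_nonempty ?_
    simp only [Finset.sum_const, Finset.card_univ, Fintype.card_fin, nsmul_eq_mul]
    push_cast
    have : 0 ≤ ((n : ℝ) + 1) * c := by positivity
    nlinarith
  refine ⟨∏ j ∈ Finset.univ.erase i, (X - C (x j)), monic_prod_of_monic _ _
    fun j _ => monic_X_sub_C _, ?_, fun y hy => ?_⟩
  · rw [natDegree_prod_of_monic _ _ fun j _ => monic_X_sub_C _]
    simp
  · rw [eval_prod, Finset.abs_prod]
    simp only [eval_sub, eval_X, eval_C]
    refine (hx i y hy).trans ?_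
    calc ∏ j ∈ Finset.univ.erase i, |x i - x j| = Real.exp (q i) := by
          rw [Real.exp_sum]
          exact Finset.prod_congr rfl fun j hj => (Real.exp_log (hpos i j hj)).symm
      _ ≤ _ := Real.exp_le_exp.mpr hi

/-! ### Monic orthogonal polynomials and their extremality -/

section OrthogonalPolynomials

variable {μ : Measure ℝ} [IsFiniteMeasure μ]

lemma integrable_of_isCompact_support (hμ : IsCompact μ.support) {f : ℝ → ℝ} (hf : Continuous f) :
    Integrable f μ := by
  have h := hf.continuousOn.integrableOn_compact (μ := μ) hμ
  rwa [IntegrableOn, Measure.restrict_eq_self_of_ae_mem (s := μ.support) Measure.support_mem_ae] at h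

lemma integrable_eval_mul_eval (hμ : IsCompact μ.support) (p q : ℝ[X]) :
    Integrable (fun x => p.eval x * q.eval x) μ :=
  integrable_of_isCompact_support hμ (p.continuous.mul q.continuous)

lemma eq_zero_of_integral_eval_mul_self (hμ : IsCompact μ.support) (hinf : μ.support.Infinite)
    {q : ℝ[X]} (hq : ∫ x, q.eval x * q.eval x ∂μ = 0) : q = 0 := by
  have h := (integral_eq_zero_iff_of_nonneg (fun x => mul_self_nonneg (q.eval x))
    (integrable_eval_mul_eval hμ q q)).mp hq
  have hcl : IsClosed {x | q.eval x = 0} := isClosed_eq q.continuous continuous_const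
  have hsub : μ.support ⊆ {x | q.eval x = 0} :=
    Measure.support_subset_of_isClosed hcl (h.mono fun x hx => mul_self_eq_zero.mp hx)
  exact eq_zero_of_infinite_isRoot q (hinf.mono hsub)

/-- The form `∫ p q dμ` is definite on polynomials of degree below `n`, so by finite dimension the
functional given by `X ^ n` is represented by some `r` there; take `X ^ n - r`. -/
lemma exists_monic_orthogonal_degreeLT (hμ : IsCompact μ.support) (hinf : μ.support.Infinite)
    (n : ℕ) : ∃ p : ℝ[X], p.Monic ∧ p.natDegree = n ∧
      ∀ q : ℝ[X], q.degree < n → ∫ x, p.eval x * q.eval x ∂μ = 0 := by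
  let B : ℝ[X] →ₗ[ℝ] ℝ[X] →ₗ[ℝ] ℝ := LinearMap.mk₂ ℝ (fun p q => ∫ x, p.eval x * q.eval x ∂μ)
    (fun p p' q => by
      simp only [eval_add, add_mul]
      exact integral_add (integrable_eval_mul_eval hμ p q) (integrable_eval_mul_eval hμ p' q))
    (fun c p q => by simp only [eval_smul, smul_eq_mul, mul_assoc, integral_const_mul])
    (fun p q q' => by
      simp only [eval_add, mul_add]
      exact integral_add (integrable_eval_mul_eval hμ p q) (integrable_eval_mul_eval hμ p q'))
    (fun c p q => by simp only [eval_smul, smul_eq_mul, mul_left_comm _ c, integral_const_mul])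
  let W := degreeLT ℝ n
  have : FiniteDimensional ℝ W := (degreeLTEquiv ℝ n).symm.finiteDimensional
  let L : W →ₗ[ℝ] Module.Dual ℝ W := B.domRestrict₁₂ W W
  have hL : Function.Injective L := by
    refine (injective_iff_map_eq_zero L).mpr fun r hr => ?_
    have h : ∫ x, (r : ℝ[X]).eval x * (r : ℝ[X]).eval x ∂μ = 0 := LinearMap.congr_fun hr r
    exact Subtype.ext (eq_zero_of_integral_eval_mul_self hμ hinf h)
  have hsurj : Function.Surjective L :=
    (LinearMap.injective_iff_surjective_of_finrank_eq_finrank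
      Subspace.dual_finrank_eq.symm).mp hL
  obtain ⟨r, hr⟩ := hsurj ((B (X ^ n)).domRestrict W)
  have hrd : (r : ℝ[X]).degree < n := mem_degreeLT.mp r.2
  refine ⟨X ^ n - (r : ℝ[X]), monic_X_pow_sub hrd, ?_, fun q hq => ?_⟩
  · refine natDegree_eq_of_degree_eq_some ?_
    rw [degree_sub_eq_left_of_degree_lt (by rwa [degree_X_pow]), degree_X_pow]
  · have h : B r q = B (X ^ n) q := LinearMap.congr_fun hr ⟨q, mem_degreeLT.mpr hq⟩
    have h2 : B (X ^ n - (r : ℝ[X])) q = 0 := by rw [map_sub, LinearMap.sub_apply, h, sub_self]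
    exact h2

lemma lintegral_enorm_eval_sq (hμ : IsCompact μ.support) (q : ℝ[X]) :
    ∫⁻ x, ‖q.eval x‖ₑ ^ 2 ∂μ = ENNReal.ofReal (∫ x, q.eval x * q.eval x ∂μ) := by
  rw [ofReal_integral_eq_lintegral_ofReal (integrable_eval_mul_eval hμ q q)
    (Eventually.of_forall fun x => mul_self_nonneg (q.eval x))]
  refine lintegral_congr fun x => ?_
  rw [Real.enorm_eq_ofReal_abs, ← ENNReal.ofReal_pow (abs_nonneg _), sq_abs, sq]

/-- Monic orthogonal polynomials minimize the `L²` norm among monic polynomials. -/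
lemma lintegral_sq_le_of_orthogonal (hμ : IsCompact μ.support) {p q : ℝ[X]} (hp : p.Monic)
    (hq : q.Monic) (hpq : q.natDegree = p.natDegree)
    (horth : ∀ q : ℝ[X], q.degree < p.natDegree → ∫ x, p.eval x * q.eval x ∂μ = 0) :
    ∫⁻ x, ‖p.eval x‖ₑ ^ 2 ∂μ ≤ ∫⁻ x, ‖q.eval x‖ₑ ^ 2 ∂μ := by
  rw [lintegral_enorm_eval_sq hμ, lintegral_enorm_eval_sq hμ]
  refine ENNReal.ofReal_le_ofReal ?_
  -- The leading terms cancel, so `q - p` is orthogonal to `p` and Pythagoras applies.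
  have hdeg : (q - p).degree < p.natDegree := by
    rw [← hpq, ← degree_eq_natDegree hq.ne_zero]
    refine degree_sub_lt_left ?_ hq.ne_zero (by rw [hq.leadingCoeff, hp.leadingCoeff])
    rw [degree_eq_natDegree hq.ne_zero, degree_eq_natDegree hp.ne_zero, hpq]
  have h0 := horth _ hdeg
  have hexp : ∀ x, q.eval x * q.eval x = p.eval x * p.eval x +
      (2 * (p.eval x * (q - p).eval x) + (q - p).eval x * (q - p).eval x) := fun x => by
    rw [eval_sub]; ring
  have hi := integrable_eval_mul_eval hμ p p
  have hi1 := (integrable_eval_mul_eval hμ p (q - p)).const_mul 2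
  have hi2 := integrable_eval_mul_eval hμ (q - p) (q - p)
  simp_rw [hexp]
  rw [integral_add hi (g := fun x => 2 * (p.eval x * (q - p).eval x) + (q - p).eval x * (q - p).eval x)
    (hi1.add hi2), integral_add hi1 hi2, integral_const_mul, h0]
  have : 0 ≤ ∫ x, (q - p).eval x * (q - p).eval x ∂μ :=
    integral_nonneg fun x => mul_self_nonneg _
  linarith

/-- A measure of compact infinite support has monic orthogonal polynomials, and these minimize the
`L²` norm among monic polynomials. -/
theorem exists_isMonicOrthogonal (hμ : IsCompact μ.support) (hinf : μ.support.Infinite) :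
    ∃ P : ℕ → ℝ[X], IsMonicOrthogonal μ P ∧ ∀ n, ∀ q : ℝ[X], q.Monic → q.natDegree = n →
      ∫⁻ x, ‖(P n).eval x‖ₑ ^ 2 ∂μ ≤ ∫⁻ x, ‖q.eval x‖ₑ ^ 2 ∂μ := by
  choose P hP hdeg horth using fun n => exists_monic_orthogonal_degreeLT hμ hinf n
  have hlt : ∀ m n, m < n → (P m).degree < n := fun m n hmn => by
    rw [degree_eq_natDegree (hP m).ne_zero, hdeg m]
    exact_mod_cast hmn
  refine ⟨P, ⟨fun n => ⟨hP n, hdeg n⟩, fun m n hmn => ?_⟩, fun n q hq hqn => ?_⟩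
  · rcases lt_or_gt_of_ne hmn with h | h
    · simp_rw [mul_comm ((P m).eval _)]
      exact horth n _ (hlt m n h)
    · exact horth m _ (hlt n m h)
  · refine lintegral_sq_le_of_orthogonal hμ (hP n) hq (by rw [hqn, hdeg]) fun q hq => ?_
    rw [hdeg] at hq
    exact horth n q hq

end OrthogonalPolynomials

/-! ### Roots of the bounds and conclusion -/

lemma tendsto_rpow_const_mul_exp {κ : ℝ} (hκ : 0 < κ) (t : ℝ) :
    Tendsto (fun n : ℕ => (ENNReal.ofReal (κ * Real.exp (2 * n * t)) ^ (1 / 2 : ℝ)) ^ (1 / (n : ℝ)))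
      atTop (𝓝 (ENNReal.ofReal (Real.exp t))) := by
  have h1 : Tendsto (fun n : ℕ => (κ ^ (1 / 2 : ℝ)) ^ (1 / (n : ℝ)) * Real.exp t) atTop
      (𝓝 (Real.exp t)) := by
    have := (tendsto_const_nhds (x := κ ^ (1 / 2 : ℝ)) (f := atTop (α := ℕ))).rpow
      (tendsto_one_div_atTop_nhds_zero_nat (𝕜 := ℝ)) (Or.inl (by positivity))
    simpa using this.mul_const (Real.exp t)
  refine (ENNReal.tendsto_ofReal h1).congr' ?_
  filter_upwards [eventually_gt_atTop 0] with n hn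
  have hn' : (n : ℝ) ≠ 0 := by exact_mod_cast hn.ne'
  rw [ENNReal.ofReal_rpow_of_pos (by positivity), ENNReal.ofReal_rpow_of_pos (by positivity),
    Real.mul_rpow hκ.le (Real.exp_pos _).le, Real.mul_rpow (by positivity) (by positivity),
    ← Real.exp_mul, ← Real.exp_mul]
  congr 3
  field_simp

lemma eLpNorm_two_eq {α : Type*} [MeasurableSpace α] (μ : Measure α) (f : α → ℝ) :
    eLpNorm f 2 μ = (∫⁻ x, ‖f x‖ₑ ^ 2 ∂μ) ^ (1 / 2 : ℝ) := by
  rw [eLpNorm_eq_lintegral_rpow_enorm_toReal (by simp) (by simp)]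
  simp

lemma measure_eq_zero_of_countable {d : ℝ} {ν : Measure ℝ} (h : shiftedEnergy d ν ≠ ⊤)
    {s : Set ℝ} (hs : s.Countable) : ν s = 0 := by
  have : NullSingletonClass ν := ⟨measure_singleton_of_shiftedEnergy_ne_top h⟩
  exact hs.measure_zero ν

lemma probOn_mono {X : Type*} [MeasurableSpace X] {s t : Set X} (h : s ⊆ t) :
    probOn s ⊆ probOn t :=
  fun _ hν => ⟨hν.1, measure_mono_null (Set.compl_subset_compl.mpr h) hν.2⟩

theorem theorem1p10 (μ : Measure ℝ) [IsFiniteMeasure μ] (hμ : IsCompact μ.support)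
    (hE : 0 < logCapacity (sigmaEss μ))
    (ρ : Measure ℝ) (hρ : IsEquilibriumMeasure (sigmaEss μ) ρ) (hac : ρ ≪ μ) :
    IsRegularMeasure μ := by
  set S := μ.support
  have hEc : IsCompact (sigmaEss μ) := isCompact_accPt hμ
  have hES : sigmaEss μ ⊆ S := fun x hx => hx.1
  obtain ⟨R, hR1, hSR⟩ : ∃ R : ℝ, 1 ≤ R ∧ S ⊆ Set.Icc (-R) R := by
    obtain ⟨r, hr⟩ := hμ.isBounded.exists_norm_le
    refine ⟨max r 1, le_max_right _ _, fun x hx => ?_⟩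
    exact abs_le.mp ((hr x hx).trans (le_max_left _ _))
  set K := Set.Icc (-R) R
  set d₀ := Real.log (2 * R)
  have hd₀ : 0 ≤ d₀ := Real.log_nonneg (by linarith)
  have hK₀ : ∀ x ∈ K, ∀ y ∈ K, x ≠ y → Real.log |x - y| ≤ d₀ := fun x hx y hy hxy =>
    Real.log_le_log (abs_pos.mpr (sub_ne_zero.mpr hxy))
      (abs_le.mpr ⟨by linarith [hx.1, hy.2], by linarith [hx.2, hy.1]⟩)
  -- Already `d₀` makes the kernel nonnegative; the extra `1` forces `b ≥ 1`, leaving room for `0 <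
  -- c < b` in the upper bound.
  set d := d₀ + 1
  have hd : 0 ≤ d := by linarith
  have hK : ∀ x ∈ K, ∀ y ∈ K, x ≠ y → Real.log |x - y| ≤ d := fun x hx y hy hxy =>
    (hK₀ x hx y hy hxy).trans (by linarith)
  have hSK : probOn S ⊆ probOn K := probOn_mono hSR
  have hEK : probOn (sigmaEss μ) ⊆ probOn K := (probOn_mono hES).trans hSK
  have hen : ∀ ν ∈ probOn K, logEnergy ν + d = shiftedEnergy d ν := fun ν hν =>
    logEnergy_add_eq_shiftedEnergy hd hK hν
  obtain ⟨hρE, hρmin⟩ := hρ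
  have hprob : IsProbabilityMeasure ρ := hρE.1
  have hmin : ∀ ν ∈ probOn (sigmaEss μ), shiftedEnergy d ρ ≤ shiftedEnergy d ν := fun ν hν => by
    rw [← EReal.coe_ennreal_le_coe_ennreal_iff, ← hen ρ (hEK hρE), ← hen ν (hEK hν)]
    exact add_le_add_left (hρmin ν hν) _
  have hne : logEnergy ρ ≠ ⊤ := fun htop => by
    have : (⨅ ν ∈ probOn (sigmaEss μ), logEnergy ν) = ⊤ :=
      iInf₂_eq_top.mpr fun ν hν => top_le_iff.mp (htop ▸ hρmin ν hν)
    rw [logCapacity, this] at hE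
    simp at hE
  have hfin : shiftedEnergy d ρ ≠ ⊤ := fun htop => by
    have h := hen ρ (hEK hρE)
    rw [htop, EReal.coe_ennreal_top] at h
    exact EReal.add_ne_top hne (EReal.coe_ne_top d) h
  set b := (shiftedEnergy d ρ).toReal
  have hbe : shiftedEnergy d ρ = ENNReal.ofReal b := (ENNReal.ofReal_toReal hfin).symm
  have hb0 : 0 ≤ b := ENNReal.toReal_nonneg
  have hlog : logEnergy ρ = ((b - d : ℝ) : EReal) := by
    have h := hen ρ (hEK hρE)
    rw [hbe, EReal.coe_ennreal_ofReal, max_eq_left hb0] at h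
    rw [EReal.coe_sub, ← h, EReal.add_sub_cancel_right]
  have hb1 : 0 < b := by
    have h := logEnergy_add_eq_shiftedEnergy hd₀ hK₀ (hEK hρE)
    rw [hlog, ← EReal.coe_add] at h
    have h2 : ((0 : ℝ) : EReal) ≤ ((b - d + d₀ : ℝ) : EReal) := by
      rw [h]; exact EReal.coe_ennreal_nonneg _
    have h3 : 0 ≤ b - d + d₀ := EReal.coe_le_coe_iff.mp h2
    linarith
  have hSmin : ∀ ν ∈ probOn S, shiftedEnergy d ρ ≤ shiftedEnergy d ν := fun ν hν => by
    by_cases ht : shiftedEnergy d ν = ⊤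
    · rw [ht]; exact le_top
    · refine hmin ν ⟨hν.1, ?_⟩
      have h1 : ν (S \ sigmaEss μ) = 0 := measure_eq_zero_of_countable ht (countable_diff_accPt S)
      refine measure_mono_null (fun x hx => ?_) (measure_union_null hν.2 h1)
      by_cases hxS : x ∈ S
      · exact Or.inr ⟨hxS, hx⟩
      · exact Or.inl hxS
  have hcap : logCapacity S = ENNReal.ofReal (Real.exp (d - b)) := by
    have : (⨅ ν ∈ probOn S, logEnergy ν) = logEnergy ρ := by
      refine le_antisymm (iInf₂_le ρ (probOn_mono hES hρE)) (le_iInf₂ fun ν hν => ?_)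
      rw [← EReal.add_sub_cancel_right (a := logEnergy ρ) (b := d),
        ← EReal.add_sub_cancel_right (a := logEnergy ν) (b := d), hen ρ (hEK hρE), hen ν (hSK hν)]
      exact EReal.sub_le_sub (EReal.coe_ennreal_le_coe_ennreal_iff.mpr (hSmin ν hν)) le_rfl
    rw [logCapacity, this, hlog, ← EReal.coe_neg, neg_sub, EReal.exp_coe]
  have hinf : S.Infinite := fun hfinS => by
    have h1 : ρ S = 0 := measure_eq_zero_of_countable hfin hfinS.countable
    have h2 : ρ Set.univ = 0 := by
      rw [← Set.union_compl_self S]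
      exact measure_union_null h1 (probOn_mono hES hρE).2
    simp at h2
  obtain ⟨P, hP, hPmin⟩ := exists_isMonicOrthogonal hμ hinf
  refine ⟨P, hP, ?_⟩
  simp_rw [eLpNorm_two_eq]
  rw [hcap]
  have hroot : ∀ n : ℕ, Monotone fun v : ℝ≥0∞ => (v ^ (1 / 2 : ℝ)) ^ (1 / (n : ℝ)) :=
    fun n v w hvw => by
      have : (0 : ℝ) ≤ 1 / (n : ℝ) := by positivity
      dsimp only
      gcongr
  refine tendsto_order.mpr ⟨fun a ha => ?_, fun a ha => ?_⟩
  · have hcont : Tendsto (fun η : ℝ => ENNReal.ofReal (Real.exp (d - b / η))) (𝓝[<] 1)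
        (𝓝 (ENNReal.ofReal (Real.exp (d - b)))) := by
      have : ContinuousAt (fun η : ℝ => Real.exp (d - b / η)) 1 := by
        fun_prop (disch := norm_num)
      have h := (ENNReal.tendsto_ofReal this.tendsto).mono_left
        (nhdsWithin_le_nhds (s := Set.Iio 1))
      simpa using h
    obtain ⟨η, hηa, hη0, hη1⟩ := ((hcont.eventually_const_lt ha).and
      (Ioo_mem_nhdsLT (zero_lt_one (α := ℝ)))).exists
    obtain ⟨κ, hκ, hlow⟩ := exists_le_lintegral_sq_of_monic hac (by linarith) (hEK hρE).2 hK hb0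
      (fun x => hbe ▸ shiftedPotential_le_of_minimizer hEc hρE hmin hfin x) hη0 hη1
    filter_upwards [(tendsto_rpow_const_mul_exp hκ (d - b / η)).eventually_const_lt hηa] with n hn
    refine hn.trans_le (hroot n ?_)
    have h := hlow (P n) (hP.1 n).1
    rwa [(hP.1 n).2] at h
  · have hcont : Tendsto (fun c : ℝ => ENNReal.ofReal (Real.exp (d - c))) (𝓝[<] b)
        (𝓝 (ENNReal.ofReal (Real.exp (d - b)))) := by
      have : ContinuousAt (fun c : ℝ => Real.exp (d - c)) b := by fun_prop
      exact (ENNReal.tendsto_ofReal this.tendsto).mono_left nhdsWithin_le_nhds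
    obtain ⟨c, hca, hc0, hcb⟩ := ((hcont.eventually_lt_const ha).and (Ioo_mem_nhdsLT hb1)).exists
    obtain ⟨M, hM⟩ := exists_monic_abs_eval_le hμ hinf
      (fun x hx y hy => hK x (hSR hx) y (hSR hy)) hc0.le fun ν hν =>
        ((ENNReal.ofReal_lt_ofReal_iff hb1).mpr hcb).trans_le (hbe ▸ hSmin ν hν)
    -- The `+ 1` makes `κ` positive without reference to the mass of `μ`.
    set κ := Real.exp (2 * M) * (μ.real Set.univ + 1)
    have hκ : 0 < κ := by positivity
    filter_upwards [(tendsto_rpow_const_mul_exp hκ (d - c)).eventually_lt_const hca] with n hn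
    refine (hroot n ?_).trans_lt hn
    obtain ⟨Q, hQ, hQn, hQS⟩ := hM n
    refine (hPmin n Q hQ hQn).trans ?_
    have hae : ∀ᵐ x ∂μ, x ∈ S := Measure.support_mem_ae
    calc ∫⁻ x, ‖Q.eval x‖ₑ ^ 2 ∂μ
        ≤ ∫⁻ _, ENNReal.ofReal (Real.exp (n * (d - c) + M) ^ 2) ∂μ := by
          refine lintegral_mono_ae ?_
          filter_upwards [hae] with x hx
          rw [Real.enorm_eq_ofReal_abs, ← ENNReal.ofReal_pow (abs_nonneg _)]
          exact ENNReal.ofReal_le_ofReal (pow_le_pow_left₀ (abs_nonneg _) (hQS x hx) 2)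
      _ = ENNReal.ofReal (Real.exp (n * (d - c) + M) ^ 2 * μ.real Set.univ) := by
          rw [lintegral_const, ENNReal.ofReal_mul (by positivity), ofReal_measureReal]
      _ ≤ _ := by
          refine ENNReal.ofReal_le_ofReal ?_
          have e : Real.exp (n * (d - c) + M) ^ 2 =
              Real.exp (2 * M) * Real.exp (2 * n * (d - c)) := by
            rw [← Real.exp_nat_mul, ← Real.exp_add]
            congr 1; push_cast; ring
          rw [e, mul_right_comm]
          exact mul_le_mul_of_nonneg_right (mul_le_mul_of_nonneg_left (by linarith)
            (Real.exp_pos _).le) (Real.exp_pos _).le
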